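/- Let $A$ be a bounded linear operator on a complex Hilbert space $\mathcal H$, let $W(A)=\{\langle Af,f\rangle : f\in\mathcal H,\ \|f\|=1\}\subset\mathbb C$ be its numerical range, and let $\lambda\in\partial W(A)$ be a point of infinite upper curvature of $\partial W(A)$; it is not assumed that $\lambda\in W(A)$. Then $\lambda$ belongs to the approximate point spectrum $\sigma_{ap}(A)$, i.e. $\lambda\in\sigma(A)$ and there are unit vectors $u_n\in\mathcal H$ with $(A-\lambda)u_n\to 0$ as $n\to\infty$. Here $\lambda$ is called a point of infinite upper curvature if either $\lambda$ is a corner point of $W(A)$, meaning that $W(A)$ is contained in a sector with vertex $\lambda$ and angle less than $\pi$, or $\lambda$ is not a corner point and, with $\Omega\subset\mathbb C\cong\mathbb R^2$ denoting the image of $W(A)$ under a translation and rotation which takes $\lambda$ to $0$ and $W(A)$ into the closed upper half-plane, $$\limsup_{\substack{(x,y)\to 0\\ x\ne 0,\ (x,y)\in\partial\Omega}}\frac{y}{x^2}=\infty .$$ -/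

import Mathlib

open Filter Topology Set

namespace NumericalRange

/-- The numerical range `W(A) = {⟨A f, f⟩ : ‖f‖ = 1}`. The inner product of Mathlib is linear in its
second argument, so the quantity linear in `A f` is `inner ℂ f (A f)`. -/
def numericalRange {H : Type*} [NormedAddCommGroup H] [InnerProductSpace ℂ H]
    (A : H →L[ℂ] H) : Set ℂ :=
  {z | ∃ f : H, ‖f‖ = 1 ∧ inner ℂ f (A f) = z}

/-- The approximate point spectrum: those `z` in the spectrum of `A` for which there are unit
vectors `u n` with `(A - z) (u n) → 0`. -/
def approxPointSpectrum {H : Type*} [NormedAddCommGroup H] [InnerProductSpace ℂ H]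
    (A : H →L[ℂ] H) : Set ℂ :=
  {z | z ∈ spectrum ℂ A ∧
    ∃ u : ℕ → H, (∀ n, ‖u n‖ = 1) ∧ Tendsto (fun n => A (u n) - z • u n) atTop (𝓝 0)}

/-- The closed sector with vertex `v`, opening angle `α`, and first bounding ray in the direction
`exp (i t₀)`. -/
def sector (v : ℂ) (t₀ α : ℝ) : Set ℂ :=
  {z | ∃ r t : ℝ, 0 ≤ r ∧ t₀ ≤ t ∧ t ≤ t₀ + α ∧ z = v + (r : ℂ) * Complex.exp ((t : ℂ) * Complex.I)}

/-- The boundary point `p` of `Ω` is a corner point if `Ω` is contained in a sector with vertex `p`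
and angle less than `π`. -/
def IsCornerPoint (Ω : Set ℂ) (p : ℂ) : Prop :=
  p ∈ frontier Ω ∧ ∃ t₀ α : ℝ, 0 ≤ α ∧ α < Real.pi ∧ Ω ⊆ sector p t₀ α

/-- The image of `Ω` under the rigid motion `z ↦ u * (z - p)` (for `‖u‖ = 1`), which takes `p`
to `0`. -/
def normalized (Ω : Set ℂ) (p u : ℂ) : Set ℂ :=
  (fun z => u * (z - p)) '' Ω

/-- The limes superior, in the extended real numbers, of `y / x ^ 2` as `(x, y) → (0, 0)` through
points of `∂S` with `x ≠ 0`. -/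
noncomputable def upperCurvatureAtZero (S : Set ℂ) : EReal :=
  limsup (fun z : ℂ => ((z.im / z.re ^ 2 : ℝ) : EReal)) (𝓝[{z : ℂ | z ∈ frontier S ∧ z.re ≠ 0}] 0)

/-- The boundary point `p` of the (convex) set `Ω` is a point of infinite upper curvature: either it
is a corner point (which counts as such by definition), or, after a translation and rotation
taking `p` to `0` and `Ω` into the closed upper half-plane, the upper curvature at `0` is infinite.
At a boundary point of a convex set that is not a corner point the real line is then automatically
the unique supporting line through `0`, and the value of the upper curvature does not depend on the
choice of the rotation. -/
def IsInfiniteUpperCurvaturePoint (Ω : Set ℂ) (p : ℂ) : Prop :=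
  p ∈ frontier Ω ∧
    (IsCornerPoint Ω p ∨
      (¬ IsCornerPoint Ω p ∧ ∃ u : ℂ, ‖u‖ = 1 ∧ normalized Ω p u ⊆ {z : ℂ | 0 ≤ z.im} ∧
        upperCurvatureAtZero (normalized Ω p u) = ⊤))

end NumericalRange

/-!
Translate and rotate: put `T = u (A - p)` with `‖u‖ = 1`, so that `W(T)` is the normalized image of
`W(A)` and `0 ∈ closure W(T)`. It suffices to find unit vectors `f n` with `T (f n) → 0`. Write
`T = X + i Y` with `X`, `Y` symmetric. The basic tool is that a positive operator `P` satisfies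
`‖P f‖² ≤ (‖P‖ + 1) ⟨f, P f⟩`, so `⟨f n, P (f n)⟩ → 0` forces `P (f n) → 0`
(`tendsto_apply_zero_of_nonneg`).

At a corner point, the rotation can be chosen so that `c |im w| ≤ re w` on `W(T)` for some `c > 0`.
Then `X + c Y` and `X - c Y` are positive, and both tend to `0` along any unit vectors `f n` with
`⟨f n, T (f n)⟩ → 0`; hence so does `T (f n)`.

At a point of infinite upper curvature with `W(T)` in the upper half-plane, `Y` is positive, so
`Y (f n) → 0`. Suppose that `T` is bounded below on unit vectors. Then `‖X (f n)‖` stays away from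
`0`, and for small real `s` the vector `g = f n + s X (f n)`, with `n` large depending on `s`, has
`⟨g, X g⟩ ≈ 2 s ‖X (f n)‖²` and `⟨g, Y g⟩ = O(s²)`: the numerical range contains points to the left
and to the right of `0` below a fixed parabola (`exists_mem_le_parabola`). By the
Toeplitz–Hausdorff theorem (`convex_numericalRange`), `W(T)` is convex, so there is a supporting line
at every frontier point `z`. Compared with `0`, with the points below the parabola, and with one
point off the real axis, this line forces `z.im ≤ K * z.re ^ 2` for `z` near `0`
(`exists_frontier_im_le_mul_sq`), against infinite curvature.
-/

namespace NumericalRange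

variable {H : Type*} [NormedAddCommGroup H] [InnerProductSpace ℂ H]

/-! ### Symmetric operators and quadratic forms -/

theorem re_inner_add_real_smul_apply {Z : H →L[ℂ] H} (hZ : Z.IsSymmetric) (v h : H) (s : ℝ) :
    (inner ℂ (v + (s : ℂ) • h) (Z (v + (s : ℂ) • h))).re
      = (inner ℂ v (Z v)).re + 2 * s * (inner ℂ h (Z v)).re + s ^ 2 * (inner ℂ h (Z h)).re := by
  have h1 : (inner ℂ v (Z h)).re = (inner ℂ h (Z v)).re := by
    rw [show inner ℂ v (Z h) = inner ℂ (Z v) h from (hZ v h).symm]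
    exact inner_re_symm (𝕜 := ℂ) _ _
  simp only [map_add, map_smul, inner_add_left, inner_add_right, inner_smul_left,
    inner_smul_right, Complex.conj_ofReal, Complex.add_re, Complex.re_ofReal_mul, h1]
  ring

theorem re_inner_self_eq_norm_sq (v : H) : (inner ℂ v v).re = ‖v‖ ^ 2 := by
  rw [inner_self_eq_norm_sq_to_K]; norm_cast

/-- Evaluating the form of a positive operator at `f - t P f` with `t = (‖P‖ + 1)⁻¹` bounds `‖P f‖²`
by the value at `f`; no square root of `P` is needed. -/
theorem norm_sq_apply_le_of_nonneg {P : H →L[ℂ] H} (hP : P.IsSymmetric)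
    (hpos : ∀ f, 0 ≤ (inner ℂ f (P f)).re) (f : H) :
    ‖P f‖ ^ 2 ≤ (‖P‖ + 1) * (inner ℂ f (P f)).re := by
  set M := ‖P‖
  have hM : 0 ≤ M := norm_nonneg _
  set t : ℝ := 1 / (M + 1) with ht
  have h1 := hpos (f + ((-t : ℝ) : ℂ) • P f)
  rw [re_inner_add_real_smul_apply hP, re_inner_self_eq_norm_sq] at h1
  have h2 : (inner ℂ (P f) (P (P f))).re ≤ M * ‖P f‖ ^ 2 := by
    calc _ ≤ ‖inner ℂ (P f) (P (P f))‖ := Complex.re_le_norm _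
      _ ≤ ‖P f‖ * ‖P (P f)‖ := norm_inner_le_norm _ _
      _ ≤ ‖P f‖ * (M * ‖P f‖) := by gcongr; exact P.le_opNorm _
      _ = _ := by ring
  have hk : (M + 1) * t = 1 := by rw [ht]; field_simp
  have ht0 : 0 < t := by positivity
  have h4 : t * ‖P f‖ ^ 2 ≤ (inner ℂ f (P f)).re := by
    have : t ^ 2 * (inner ℂ (P f) (P (P f))).re ≤ t ^ 2 * (M * ‖P f‖ ^ 2) := by gcongr
    have h5 : t ^ 2 * (M * ‖P f‖ ^ 2) = (t - t ^ 2) * ‖P f‖ ^ 2 := by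
      have : t * M = 1 - t := by linarith
      linear_combination t * ‖P f‖ ^ 2 * this
    nlinarith [mul_nonneg (sq_nonneg t) (sq_nonneg ‖P f‖)]
  calc ‖P f‖ ^ 2 = (M + 1) * (t * ‖P f‖ ^ 2) := by linear_combination -‖P f‖ ^ 2 * hk
    _ ≤ _ := by gcongr

theorem tendsto_apply_zero_of_nonneg {P : H →L[ℂ] H} (hP : P.IsSymmetric)
    (hpos : ∀ f, 0 ≤ (inner ℂ f (P f)).re) {f : ℕ → H}
    (hf : Tendsto (fun n => (inner ℂ (f n) (P (f n))).re) atTop (𝓝 0)) :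
    Tendsto (fun n => P (f n)) atTop (𝓝 0) := by
  rw [tendsto_zero_iff_norm_tendsto_zero]
  have h : Tendsto (fun n => ‖P (f n)‖ ^ 2) atTop (𝓝 0) :=
    squeeze_zero (fun _ => sq_nonneg _) (fun n => norm_sq_apply_le_of_nonneg hP hpos (f n))
      (by simpa using hf.const_mul (‖P‖ + 1))
  simpa [Real.sqrt_sq (norm_nonneg _)] using h.sqrt

/-- The Cartesian decomposition of an operator. -/
theorem exists_isSymmetric_add_I_smul [CompleteSpace H] (T : H →L[ℂ] H) :
    ∃ X Y : H →L[ℂ] H, X.IsSymmetric ∧ Y.IsSymmetric ∧ T = X + Complex.I • Y := by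
  refine ⟨realPart T, imaginaryPart T, ?_, ?_, (realPart_add_I_smul_imaginaryPart T).symm⟩
  · exact (ContinuousLinearMap.isSelfAdjoint_iff_isSymmetric).1 (realPart T).2
  · exact (ContinuousLinearMap.isSelfAdjoint_iff_isSymmetric).1 (imaginaryPart T).2

theorem inner_apply_im_eq_zero {X : H →L[ℂ] H} (hX : X.IsSymmetric) (f : H) :
    (inner ℂ f (X f)).im = 0 := by
  rw [← Complex.conj_eq_iff_im, inner_conj_symm]
  exact hX f f

theorem re_inner_add_I_smul {X Y : H →L[ℂ] H} (hY : Y.IsSymmetric) (f : H) :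
    (inner ℂ f ((X + Complex.I • Y) f)).re = (inner ℂ f (X f)).re := by
  simp [inner_apply_im_eq_zero hY]

theorem im_inner_add_I_smul {X Y : H →L[ℂ] H} (hX : X.IsSymmetric) (f : H) :
    (inner ℂ f ((X + Complex.I • Y) f)).im = (inner ℂ f (Y f)).re := by
  simp [inner_apply_im_eq_zero hX]

theorem inner_div_norm_sq_mem (T : H →L[ℂ] H) {g : H} (hg : g ≠ 0) :
    inner ℂ g (T g) / ((‖g‖ ^ 2 : ℝ) : ℂ) ∈ numericalRange T := by
  have hg' : (‖g‖ : ℂ) ≠ 0 := by simpa using hg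
  refine ⟨((‖g‖⁻¹ : ℝ) : ℂ) • g, ?_, ?_⟩
  · rw [norm_smul]; simp [hg]
  · simp only [map_smul, inner_smul_left, inner_smul_right, Complex.conj_ofReal]
    push_cast
    field_simp

/-! ### Approximate eigenvectors from a sector -/

theorem exists_seq_of_zero_mem_closure {T : H →L[ℂ] H} (h0 : 0 ∈ closure (numericalRange T)) :
    ∃ f : ℕ → H, (∀ n, ‖f n‖ = 1) ∧ Tendsto (fun n => inner ℂ (f n) (T (f n))) atTop (𝓝 0) := by
  obtain ⟨w, hw, hlim⟩ := mem_closure_iff_seq_limit.1 h0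
  choose f hf hfw using hw
  exact ⟨f, hf, by simpa only [hfw] using hlim⟩

/-- The case of a corner at `0`: the operators `X ± c Y` are positive, where `T = X + i Y`. -/
theorem exists_seq_tendsto_of_sector [CompleteSpace H] {T : H →L[ℂ] H}
    (h0 : 0 ∈ closure (numericalRange T)) {c : ℝ} (hc : 0 < c)
    (hsec : ∀ w ∈ numericalRange T, c * |w.im| ≤ w.re) :
    ∃ f : ℕ → H, (∀ n, ‖f n‖ = 1) ∧ Tendsto (fun n => T (f n)) atTop (𝓝 0) := by
  obtain ⟨f, hf, hlim⟩ := exists_seq_of_zero_mem_closure h0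
  obtain ⟨X, Y, hX, hY, rfl⟩ := exists_isSymmetric_add_I_smul T
  refine ⟨f, hf, ?_⟩
  have hhom : ∀ g : H, c * |(inner ℂ g (Y g)).re| ≤ (inner ℂ g (X g)).re := by
    intro g
    rcases eq_or_ne g 0 with rfl | hg
    · simp
    have hn : 0 < ‖g‖ ^ 2 := by positivity
    have := hsec _ (inner_div_norm_sq_mem _ hg)
    rw [Complex.div_ofReal_re, Complex.div_ofReal_im, re_inner_add_I_smul hY,
      im_inner_add_I_smul hX, abs_div, abs_of_pos hn, ← mul_div_assoc,
      div_le_div_iff_of_pos_right hn] at this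
    exact this
  have hXl : Tendsto (fun n => (inner ℂ (f n) (X (f n))).re) atTop (𝓝 0) := by
    simpa only [Function.comp_def, re_inner_add_I_smul hY, Complex.zero_re] using
      (Complex.continuous_re.tendsto 0).comp hlim
  have hYl : Tendsto (fun n => (inner ℂ (f n) (Y (f n))).re) atTop (𝓝 0) := by
    simpa only [Function.comp_def, im_inner_add_I_smul hX, Complex.zero_im] using
      (Complex.continuous_im.tendsto 0).comp hlim
  have key : ∀ d : ℝ, |d| = c → Tendsto (fun n => (X + (d : ℂ) • Y) (f n)) atTop (𝓝 0) := by
    intro d hd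
    have hre : ∀ g, (inner ℂ g ((X + (d : ℂ) • Y) g)).re
        = (inner ℂ g (X g)).re + d * (inner ℂ g (Y g)).re := by
      intro g; simp
    refine tendsto_apply_zero_of_nonneg ?_ ?_ ?_
    · have hd' : starRingEnd ℂ (d : ℂ) = d := Complex.conj_ofReal d
      exact hX.add (hY.smul hd')
    · intro g
      rw [hre]
      have h1 := hhom g
      rw [← hd, ← abs_mul] at h1
      linarith [neg_abs_le (d * (inner ℂ g (Y g)).re)]
    · simp only [hre]
      simpa using hXl.add (hYl.const_mul d)
  have h1 := key c (abs_of_pos hc)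
  have h2 := key (-c) (by rw [abs_neg, abs_of_pos hc])
  have h3 := ((h1.add h2).const_smul (1 / 2 : ℂ)).add
    ((h1.sub h2).const_smul (Complex.I / (2 * c) : ℂ))
  have hc' : (c : ℂ) ≠ 0 := by exact_mod_cast hc.ne'
  have e : ∀ n, (X + Complex.I • Y) (f n)
      = (1 / 2 : ℂ) • ((X + (c : ℂ) • Y) (f n) + (X + ((-c : ℝ) : ℂ) • Y) (f n))
      + (Complex.I / (2 * c) : ℂ) • ((X + (c : ℂ) • Y) (f n) - (X + ((-c : ℝ) : ℂ) • Y) (f n)) := by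
    intro n
    simp only [add_apply, smul_apply]
    push_cast
    match_scalars <;> field_simp <;> ring
  simp only [e]
  simpa using h3

/-- Membership in the spectrum comes for free: an inverse of `p - A` would send a null sequence to
the unit vectors `f n`. -/
theorem mem_approxPointSpectrum {A : H →L[ℂ] H} {p : ℂ} {f : ℕ → H} (hf : ∀ n, ‖f n‖ = 1)
    (hlim : Tendsto (fun n => A (f n) - p • f n) atTop (𝓝 0)) : p ∈ approxPointSpectrum A := by
  refine ⟨?_, f, hf, hlim⟩
  rw [spectrum.mem_iff]
  rintro ⟨v, hv⟩
  have h1 : ∀ n, f n = -((↑v⁻¹ : H →L[ℂ] H) (A (f n) - p • f n)) := by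
    intro n
    have h2 : (v : H →L[ℂ] H) (f n) = -(A (f n) - p • f n) := by
      rw [hv]; simp [Algebra.algebraMap_eq_smul_one]
    rw [← map_neg, ← h2, ← mul_apply_eq_comp, Units.inv_mul]; rfl
  have h2 : Tendsto f atTop (𝓝 0) := by
    have := (((↑v⁻¹ : H →L[ℂ] H).continuous.tendsto 0).comp hlim).neg
    simp only [map_zero, neg_zero, Function.comp_def, ← h1] at this
    exact this
  have h3 := h2.norm
  simp only [hf, norm_zero] at h3
  exact one_ne_zero (tendsto_nhds_unique tendsto_const_nhds h3)

theorem numericalRange_smul_sub (A : H →L[ℂ] H) (p u : ℂ) :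
    numericalRange (u • (A - p • ContinuousLinearMap.id ℂ H))
      = normalized (numericalRange A) p u := by
  have key : ∀ f : H, ‖f‖ = 1 → inner ℂ f ((u • (A - p • ContinuousLinearMap.id ℂ H)) f)
      = u * (inner ℂ f (A f) - p) := by
    intro f hf
    simp [inner_self_eq_norm_sq_to_K, hf]
  ext z
  constructor
  · rintro ⟨f, hf, rfl⟩
    exact ⟨_, ⟨f, hf, rfl⟩, (key f hf).symm⟩
  · rintro ⟨_, ⟨f, hf, rfl⟩, rfl⟩
    exact ⟨f, hf, key f hf⟩

/-! ### Points of the numerical range below a parabola -/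

/-- First-order perturbation of a unit vector `v` in the direction `X v`: the point of the numerical
range at `v + s X v` has real part of the sign of `s` and at least of order `|s|`, while its imaginary
part is of order `s ^ 2`, as soon as the forms of `X` and `Y` at `v` are at most `s ^ 2` and
`‖Y v‖ ≤ |s|`. -/
theorem exists_mem_le_parabola_of_approx {X Y : H →L[ℂ] H} (hX : X.IsSymmetric)
    (hY : Y.IsSymmetric) {M d s : ℝ} (hM0 : 0 < M) (hMX : ‖X‖ ≤ M) (hMY : ‖Y‖ ≤ M) (hd0 : 0 < d)
    (hs : s ≠ 0) (hs0 : |s| ≤ 1 / 2) (hsM : |s| * (1 + M ^ 3) ≤ d) {v : H} (hv : ‖v‖ = 1)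
    (hvX : |(inner ℂ v (X v)).re| ≤ s ^ 2) (hvY : (inner ℂ v (Y v)).re ≤ s ^ 2)
    (hYv : ‖Y v‖ ≤ |s|) (hXv : d ≤ ‖X v‖ ^ 2) :
    ∃ w ∈ numericalRange (X + Complex.I • Y), d / (3 + M ^ 2) * s ^ 2 ≤ s * w.re ∧
      w.im ≤ 2 * (1 + 2 * M + M ^ 3) * s ^ 2 := by
  have hs2 : 0 < s ^ 2 := by positivity
  have eX := re_inner_add_real_smul_apply hX v (X v) s
  have eY := re_inner_add_real_smul_apply hY v (X v) s
  have eN := re_inner_add_real_smul_apply (Z := ContinuousLinearMap.id ℂ H)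
    (fun _ _ => rfl) v (X v) s
  simp only [ContinuousLinearMap.id_apply] at eN
  have hXv' : (inner ℂ (X v) v).re = (inner ℂ v (X v)).re := congrArg Complex.re (hX v v)
  rw [re_inner_self_eq_norm_sq, re_inner_self_eq_norm_sq, re_inner_self_eq_norm_sq, hv, hXv'] at eN
  rw [re_inner_self_eq_norm_sq] at eX
  have hhM : ‖X v‖ ≤ M := by simpa [hv] using X.le_of_opNorm_le hMX v
  have hcub : ∀ Z : H →L[ℂ] H, ‖Z‖ ≤ M → |(inner ℂ (X v) (Z (X v))).re| ≤ M ^ 3 := by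
    intro Z hZ
    calc _ ≤ ‖inner ℂ (X v) (Z (X v))‖ := Complex.abs_re_le_norm _
      _ ≤ ‖X v‖ * ‖Z (X v)‖ := norm_inner_le_norm _ _
      _ ≤ M * (M * M) := by
        gcongr
        exact (Z.le_of_opNorm_le hZ _).trans (by gcongr)
      _ = _ := by ring
  have hXX := hcub X hMX
  have hYY := hcub Y hMY
  have hYc : |(inner ℂ (X v) (Y v)).re| ≤ M * |s| :=
    calc _ ≤ ‖inner ℂ (X v) (Y v)‖ := Complex.abs_re_le_norm _
      _ ≤ ‖X v‖ * ‖Y v‖ := norm_inner_le_norm _ _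
      _ ≤ M * |s| := by gcongr
  have hnM : ‖X v‖ ^ 2 ≤ M ^ 2 := by gcongr
  generalize hg : v + (s : ℂ) • X v = g at eX eY eN
  generalize (inner ℂ (X v) (X (X v))).re = xx at eX hXX
  generalize (inner ℂ (X v) (Y (X v))).re = yy at eY hYY
  generalize (inner ℂ (X v) (Y v)).re = yc at eY hYc
  generalize (inner ℂ v (X v)).re = a at eX eN hvX
  generalize (inner ℂ v (Y v)).re = q at eY hvY
  generalize ‖X v‖ ^ 2 = n at eX eN hXv hnM
  have hsq : s ^ 2 = |s| ^ 2 := (sq_abs s).symm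
  have hsa : |s * a| ≤ |s| * s ^ 2 := by rw [abs_mul]; gcongr
  have hsa1 := neg_abs_le (s * a)
  have hsa2 := le_abs_self (s * a)
  have hs21 : s ^ 2 ≤ 1 / 2 := by rw [hsq]; nlinarith [abs_nonneg s]
  have hs14 : |s| * s ^ 2 ≤ 1 / 2 * (1 / 2) := by gcongr
  have hn0 : 0 ≤ s ^ 2 * n := mul_nonneg hs2.le (hd0.le.trans hXv)
  have hNlo : 1 / 2 ≤ ‖g‖ ^ 2 := by linarith
  have hNhi : ‖g‖ ^ 2 ≤ 3 + M ^ 2 := by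
    have h1 : s ^ 2 * n ≤ s ^ 2 * M ^ 2 := by gcongr
    have h2 : s ^ 2 * M ^ 2 ≤ 1 / 2 * M ^ 2 := by gcongr
    linarith [sq_nonneg M]
  have hg0 : g ≠ 0 := by
    intro h
    rw [h] at hNlo
    norm_num at hNlo
  have hNpos : 0 < ‖g‖ ^ 2 := by linarith
  refine ⟨_, inner_div_norm_sq_mem _ hg0, ?_, ?_⟩
  · rw [Complex.div_ofReal_re, re_inner_add_I_smul hY, ← mul_div_assoc, div_mul_eq_mul_div]
    have hnum : d * s ^ 2 ≤ s * (inner ℂ g (X g)).re := by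
      have h1 : |s * (s ^ 2 * xx)| ≤ |s| * (s ^ 2 * M ^ 3) := by
        rw [abs_mul, abs_mul, abs_of_pos hs2]; gcongr
      have h2 : s ^ 2 * d ≤ s ^ 2 * n := by gcongr
      have h3 : s ^ 2 * (|s| * (1 + M ^ 3)) ≤ s ^ 2 * d := by gcongr
      rw [eX]
      linarith [neg_abs_le (s * (s ^ 2 * xx))]
    calc d * s ^ 2 / (3 + M ^ 2) ≤ d * s ^ 2 / ‖g‖ ^ 2 := by gcongr
      _ ≤ _ := by gcongr
  · rw [Complex.div_ofReal_im, im_inner_add_I_smul hX, div_le_iff₀ hNpos]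
    have hnum : (inner ℂ g (Y g)).re ≤ (1 + 2 * M + M ^ 3) * s ^ 2 := by
      have h1 : |s * yc| ≤ |s| * (M * |s|) := by
        rw [abs_mul]; gcongr
      have h2 : s ^ 2 * yy ≤ s ^ 2 * M ^ 3 := by
        gcongr; exact (le_abs_self _).trans hYY
      have h3 : |s| * (M * |s|) = M * s ^ 2 := by rw [hsq]; ring
      rw [eY]
      linarith [le_abs_self (s * yc)]
    have h4 : 2 * (1 + 2 * M + M ^ 3) * s ^ 2 * (1 / 2)
        ≤ 2 * (1 + 2 * M + M ^ 3) * s ^ 2 * ‖g‖ ^ 2 := by gcongr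
    linarith

/-- If `T` is bounded below on unit vectors and `0` is in the closure of `W(T)`, which lies in the upper
half-plane, then `W(T)` has points on both sides of the imaginary axis, at distance at least `c |s|`
from it and at height at most `C s ^ 2`, for all small `s`. -/
theorem exists_mem_le_parabola [CompleteSpace H] {T : H →L[ℂ] H}
    (hW : ∀ w ∈ numericalRange T, 0 ≤ w.im) (h0 : 0 ∈ closure (numericalRange T))
    {δ : ℝ} (hδ : 0 < δ) (hb : ∀ f, ‖f‖ = 1 → δ ≤ ‖T f‖) :
    ∃ c C s₀ : ℝ, 0 < c ∧ 0 < C ∧ 0 < s₀ ∧ ∀ s : ℝ, s ≠ 0 → |s| ≤ s₀ →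
      ∃ w ∈ numericalRange T, c * s ^ 2 ≤ s * w.re ∧ w.im ≤ C * s ^ 2 := by
  obtain ⟨f, hf, hlim⟩ := exists_seq_of_zero_mem_closure h0
  obtain ⟨X, Y, hX, hY, rfl⟩ := exists_isSymmetric_add_I_smul T
  have hpos : ∀ g, 0 ≤ (inner ℂ g (Y g)).re := by
    intro g
    rcases eq_or_ne g 0 with rfl | hg
    · simp
    have hn : 0 < ‖g‖ ^ 2 := by positivity
    have := hW _ (inner_div_norm_sq_mem _ hg)
    rw [Complex.div_ofReal_im, im_inner_add_I_smul hX] at this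
    simpa using (le_div_iff₀ hn).1 this
  have hXl : Tendsto (fun n => (inner ℂ (f n) (X (f n))).re) atTop (𝓝 0) := by
    simpa only [Function.comp_def, re_inner_add_I_smul hY, Complex.zero_re] using
      (Complex.continuous_re.tendsto 0).comp hlim
  have hYl : Tendsto (fun n => (inner ℂ (f n) (Y (f n))).re) atTop (𝓝 0) := by
    simpa only [Function.comp_def, im_inner_add_I_smul hX, Complex.zero_im] using
      (Complex.continuous_im.tendsto 0).comp hlim
  have hYf : Tendsto (fun n => ‖Y (f n)‖) atTop (𝓝 0) :=
    tendsto_zero_iff_norm_tendsto_zero.1 (tendsto_apply_zero_of_nonneg hY hpos hYl)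
  obtain ⟨M, hM0, hMX, hMY⟩ : ∃ M : ℝ, 0 < M ∧ ‖X‖ ≤ M ∧ ‖Y‖ ≤ M :=
    ⟨‖X‖ + ‖Y‖ + 1, by positivity, by linarith [norm_nonneg Y], by linarith [norm_nonneg X]⟩
  set d : ℝ := (δ / 2) ^ 2 with hd
  have hd0 : 0 < d := by positivity
  refine ⟨d / (3 + M ^ 2), 2 * (1 + 2 * M + M ^ 3), min (1 / 2) (d / (1 + M ^ 3)), by positivity,
    by positivity, by positivity, fun s hs hs0 => ?_⟩
  have hσ : 0 < |s| := abs_pos.2 hs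
  have hs2 : 0 < s ^ 2 := by positivity
  have hsM : |s| * (1 + M ^ 3) ≤ d :=
    (le_div_iff₀ (by positivity)).1 (hs0.trans (min_le_right _ _))
  replace hs0 : |s| ≤ 1 / 2 := hs0.trans (min_le_left _ _)
  obtain ⟨n, hn1, hn2, hn3, hn4⟩ := ((hXl.eventually (Metric.ball_mem_nhds 0 hs2)).and
    ((hYl.eventually (gt_mem_nhds hs2)).and ((hYf.eventually (gt_mem_nhds hσ)).and
      (hYf.eventually (gt_mem_nhds (half_pos hδ)))))).exists
  rw [dist_zero_right, Real.norm_eq_abs] at hn1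
  refine exists_mem_le_parabola_of_approx hX hY hM0 hMX hMY hd0 hs hs0 hsM (hf n) hn1.le hn2.le
    hn3.le ?_
  have h1 : ‖(X + Complex.I • Y) (f n)‖ ≤ ‖X (f n)‖ + ‖Y (f n)‖ := by
    refine (norm_add_le _ _).trans_eq ?_
    simp [norm_smul]
  have h2 : δ / 2 ≤ ‖X (f n)‖ := by linarith [hb _ (hf n)]
  rw [hd]
  gcongr

/-! ### Convexity of the numerical range -/

theorem exists_norm_eq_one_im_eq_zero (P Q : ℂ) :
    ∃ μ : ℂ, ‖μ‖ = 1 ∧ (μ * P + starRingEnd ℂ μ * Q).im = 0 := by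
  set D := P - starRingEnd ℂ Q with hD
  have him : ∀ μ : ℂ, (μ * P + starRingEnd ℂ μ * Q).im = (μ * D).im := by
    intro μ
    simp [hD]
    ring
  simp only [him]
  rcases eq_or_ne D 0 with h | h
  · exact ⟨1, by simp, by simp [h]⟩
  · refine ⟨starRingEnd ℂ D / ‖D‖, by simp [h], ?_⟩
    rw [div_mul_eq_mul_div, mul_comm, Complex.mul_conj, Complex.div_ofReal_im]
    simp

/-- The Toeplitz–Hausdorff theorem. -/
theorem convex_numericalRange (T : H →L[ℂ] H) : Convex ℝ (numericalRange T) := by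
  rw [convex_iff_segment_subset]
  rintro _ ⟨f, hf, rfl⟩ _ ⟨g, hg, rfl⟩ z hz
  rw [segment_eq_image_lineMap] at hz
  obtain ⟨θ, hθ, rfl⟩ := hz
  set α := inner ℂ f (T f) with hα
  set β := inner ℂ g (T g) with hβ
  rcases eq_or_ne α β with hab | hab
  · rw [← hab, AffineMap.lineMap_same_apply]
    exact ⟨f, hf, rfl⟩
  have hba : β - α ≠ 0 := sub_ne_zero.2 hab.symm
  -- After an affine change of variable the two given values are `0` and `1`.
  set S : H →L[ℂ] H := (β - α)⁻¹ • (T - α • ContinuousLinearMap.id ℂ H) with hS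
  have hTS : ∀ h, inner ℂ h (T h) = α * ((‖h‖ ^ 2 : ℝ) : ℂ) + (β - α) * inner ℂ h (S h) := by
    intro h
    simp only [hS, smul_apply, sub_apply, ContinuousLinearMap.id_apply, inner_smul_right,
      inner_sub_right, inner_self_eq_norm_sq_to_K]
    push_cast
    field_simp
    simp
  have hSf : inner ℂ f (S f) = 0 := by
    have := hTS f
    rw [hf, ← hα] at this
    simpa [hba] using this
  have hSg : inner ℂ g (S g) = 1 := by
    have := hTS g
    rw [hg, ← hβ] at this
    have h2 : (β - α) * inner ℂ g (S g) = (β - α) * 1 := by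
      linear_combination -this - α * (by norm_num : ((1 ^ 2 : ℝ) : ℂ) = 1)
    exact mul_left_cancel₀ hba h2
  obtain ⟨μ, hμ, him⟩ := exists_norm_eq_one_im_eq_zero (inner ℂ f (S g)) (inner ℂ g (S f))
  set r : ℝ := (μ * inner ℂ f (S g) + starRingEnd ℂ μ * inner ℂ g (S f)).re with hr
  have hr' : μ * inner ℂ f (S g) + starRingEnd ℂ μ * inner ℂ g (S f) = (r : ℂ) := by
    rw [hr, ← Complex.conj_eq_iff_re.1 (Complex.conj_eq_iff_im.2 him), Complex.ofReal_re]
  have hμμ : starRingEnd ℂ μ * μ = 1 := by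
    rw [Complex.conj_mul', hμ]; simp
  -- With this phase `μ` the form of `S` is real along the segment from `f` to `μ g`, so that the
  -- intermediate value theorem applies to its normalization.
  set k : ℝ → H := fun t => ((1 - t : ℝ) : ℂ) • f + ((t : ℝ) : ℂ) • (μ • g) with hk
  have hkS : ∀ t, inner ℂ (k t) (S (k t)) = ((t ^ 2 + t * (1 - t) * r : ℝ) : ℂ) := by
    intro t
    simp only [hk, map_add, map_smul, inner_add_left, inner_add_right, inner_smul_left,
      inner_smul_right, hSf, hSg, Complex.conj_ofReal]
    push_cast
    rw [← hr']
    linear_combination (t : ℂ) ^ 2 * hμμ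
  -- A zero of `k` would make `f` a multiple of `g`, and the values of the form of `S` would agree.
  have hk0 : ∀ t, k t ≠ 0 := by
    intro t h
    have h1 : ((1 - t : ℝ) : ℂ) • f = -(((t : ℝ) : ℂ) • (μ • g)) := eq_neg_of_add_eq_zero_left h
    have h2 := congrArg norm h1
    simp only [norm_neg, norm_smul, hf, hg, hμ, Complex.norm_real, Real.norm_eq_abs, mul_one] at h2
    have ht : t = 1 / 2 := by
      rcases abs_eq_abs.1 h2 with h3 | h3 <;> linarith
    have h3 := hkS t
    have h4 : f = (-μ) • g := by
      rw [ht] at h1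
      have h5 : ((1 - 1 / 2 : ℝ) : ℂ) = ((1 / 2 : ℝ) : ℂ) := by norm_num
      rw [h5, ← smul_neg] at h1
      have h6 : ((1 / 2 : ℝ) : ℂ) ≠ 0 := by norm_num
      rw [neg_smul]
      exact smul_right_injective H h6 h1
    rw [h4, map_smul, inner_smul_left, inner_smul_right, hSg] at hSf
    simp at hSf
    simp [hSf] at hμ
  set φ : ℝ → ℝ := fun t => (t ^ 2 + t * (1 - t) * r) / ‖k t‖ ^ 2 with hφ
  have hkc : Continuous k := by
    simp only [hk]
    fun_prop
  have hφc : Continuous φ :=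
    Continuous.div (by fun_prop) (by fun_prop) fun t => by simpa using hk0 t
  have hφ0 : φ 0 = 0 := by simp [hφ]
  have hφ1 : φ 1 = 1 := by simp [hφ, hk, norm_smul, hμ, hg]
  obtain ⟨t, -, ht⟩ := intermediate_value_Icc zero_le_one hφc.continuousOn
    (by rw [hφ0, hφ1]; exact hθ)
  have hmem := inner_div_norm_sq_mem T (hk0 t)
  convert hmem using 1
  have hn : ((‖k t‖ ^ 2 : ℝ) : ℂ) ≠ 0 := by
    have := hk0 t
    exact_mod_cast (by positivity : ‖k t‖ ^ 2 ≠ 0)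
  have hn' : ‖k t‖ ^ 2 ≠ 0 := by exact_mod_cast hn
  rw [hTS, hkS, ← ht, AffineMap.lineMap_apply, hφ]
  simp only [vsub_eq_sub, vadd_eq_add, Complex.real_smul, Complex.ofReal_div]
  field_simp
  ring

/-- A convex subset of the plane has a supporting line at each point of its frontier. If the interior
is empty, the set lies on a line, which supports it everywhere. -/
theorem exists_support {s : Set ℂ} (hs : Convex ℝ s) {z : ℂ} (hz : z ∈ frontier s) :
    ∃ a b : ℝ, (a ≠ 0 ∨ b ≠ 0) ∧ ∀ w ∈ s, a * z.re + b * z.im ≤ a * w.re + b * w.im := by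
  have key : ∀ l : ℂ →L[ℝ] ℝ, ∀ w : ℂ, l w = l 1 * w.re + l Complex.I * w.im := by
    intro l w
    have : w = w.re • (1 : ℂ) + w.im • Complex.I := by
      apply Complex.ext <;> simp
    conv_lhs => rw [this]
    rw [map_add, map_smul, map_smul]
    simp [mul_comm]
  obtain ⟨l, hl0, hl⟩ : ∃ l : ℂ →L[ℝ] ℝ, l ≠ 0 ∧ ∀ w ∈ s, l z ≤ l w := by
    rcases (interior s).eq_empty_or_nonempty with h | h
    · have hspan : affineSpan ℝ s ≠ ⊤ := fun h' => by
        simpa [h] using hs.interior_nonempty_iff_affineSpan_eq_top.2 h'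
      obtain ⟨w₀, hw₀⟩ : s.Nonempty := closure_nonempty_iff.1 ⟨z, hz.1⟩
      have hdir : vectorSpan ℝ s ≠ ⊤ := fun h' =>
        hspan ((AffineSubspace.affineSpan_eq_top_iff_vectorSpan_eq_top_of_nonempty ℝ ℂ ℂ
          ⟨w₀, hw₀⟩).2 h')
      obtain ⟨l, hl0, hl⟩ := Submodule.exists_le_ker_of_lt_top _ hdir.lt_top
      have hconst : ∀ w ∈ s, l w = l w₀ := fun w hw => by
        have h1 : l (w - w₀) = 0 := hl (vsub_mem_vectorSpan ℝ hw hw₀)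
        rwa [map_sub, sub_eq_zero] at h1
      have hclosed : IsClosed {w | l w = l w₀} :=
        isClosed_eq l.continuous_of_finiteDimensional continuous_const
      have hz' : l z = l w₀ := closure_minimal hconst hclosed hz.1
      refine ⟨LinearMap.toContinuousLinearMap l, by simpa using hl0, fun w hw => ?_⟩
      simp [hz', hconst w hw]
    · obtain ⟨l, hl0, hl⟩ := geometric_hahn_banach_of_nonempty_interior_point hs hz.2 h
      exact ⟨-l, neg_ne_zero.2 hl0, fun w hw => by simpa using hl w hw⟩
  refine ⟨l 1, l Complex.I, ?_, fun w hw => by simpa only [← key] using hl w hw⟩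
  by_contra! h
  exact hl0 (ContinuousLinearMap.ext fun w => by simp [key l w, h.1, h.2])

/-! ### Curvature of the frontier -/

/-- If a convex set in the upper half-plane has, on both sides of `0`, points below a parabola at every
small scale, then its frontier near `0` lies below a parabola. The point `w₀` off the real axis
excludes supporting lines which have the set below them. -/
theorem exists_frontier_im_le_mul_sq {S : Set ℂ} (hS : Convex ℝ S) (him : ∀ w ∈ S, 0 ≤ w.im)
    (h0 : 0 ∈ closure S) {w₀ : ℂ} (hw₀ : w₀ ∈ S) (hw₀im : 0 < w₀.im) {c C s₀ : ℝ} (hc : 0 < c)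
    (hs₀ : 0 < s₀) (hpar : ∀ s : ℝ, s ≠ 0 → |s| ≤ s₀ →
      ∃ w ∈ S, c * s ^ 2 ≤ s * w.re ∧ w.im ≤ C * s ^ 2) :
    ∃ K r : ℝ, 0 < r ∧ ∀ z ∈ frontier S, z.re ≠ 0 → ‖z‖ < r → z.im ≤ K * z.re ^ 2 := by
  set B : ℝ := 1 + 2 / (c * s₀) * (|w₀.re| + 1) with hB
  have hB0 : 0 < B := by positivity
  refine ⟨C * (2 / c) ^ 2, min (min 1 (c * s₀ / 2)) (w₀.im / B), by positivity,
    fun z hz hx hzr => ?_⟩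
  obtain ⟨a, b, hab, hsupp⟩ := exists_support hS hz
  have hxz := Complex.abs_re_le_norm z
  have hyz := Complex.im_le_norm z
  have hr1 : |z.re| < 1 := by
    linarith [(hzr.trans_le (min_le_left _ _)).trans_le (min_le_left _ _)]
  have hr2 : |z.re| < c * s₀ / 2 := by
    linarith [(hzr.trans_le (min_le_left _ _)).trans_le (min_le_right _ _)]
  have hr3 : z.im * B < w₀.im :=
    (lt_div_iff₀ hB0).1 (hyz.trans_lt (hzr.trans_le (min_le_right _ _)))
  have hy0 : 0 ≤ z.im :=
    closure_minimal him (isClosed_le continuous_const Complex.continuous_im) hz.1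
  have hx0 : 0 < |z.re| := abs_pos.2 hx
  have hax : -(|a| * |z.re|) ≤ a * z.re := by rw [← abs_mul]; exact neg_abs_le _
  have htest : ∀ t : ℝ, 0 < t → t ≤ s₀ → ∃ w ∈ S, a * w.re ≤ -(|a| * (c * t)) ∧
      w.im ≤ C * t ^ 2 := by
    intro t ht hts
    rcases le_or_gt a 0 with ha | ha
    · obtain ⟨w, hw, h1, h2⟩ := hpar t ht.ne' (by rwa [abs_of_pos ht])
      refine ⟨w, hw, ?_, h2⟩
      have h3 : c * t ≤ w.re := le_of_mul_le_mul_left (by linarith) ht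
      rw [abs_of_nonpos ha]
      nlinarith
    · obtain ⟨w, hw, h1, h2⟩ := hpar (-t) (by simpa using ht.ne') (by rwa [abs_neg, abs_of_pos ht])
      refine ⟨w, hw, ?_, by simpa using h2⟩
      have h3 : c * t ≤ -w.re := le_of_mul_le_mul_left (by linarith) ht
      rw [abs_of_pos ha]
      nlinarith
  -- In both cases the test point is taken on the side where `a * w.re` is negative.
  rcases lt_or_ge 0 b with hb | hb
  · have hzero : a * z.re + b * z.im ≤ 0 := by
      have : (0 : ℂ) ∈ {w : ℂ | a * z.re + b * z.im ≤ a * w.re + b * w.im} :=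
        closure_minimal hsupp (isClosed_le continuous_const
          ((continuous_const.mul Complex.continuous_re).add
            (continuous_const.mul Complex.continuous_im))) h0
      simpa using this
    -- At this scale the test point lies at least twice as far from the imaginary axis as `z`.
    obtain ⟨w, hw, h1, h2⟩ := htest (2 / c * |z.re|) (by positivity) (by
      rw [div_mul_eq_mul_div, div_le_iff₀ hc]; linarith)
    have h3 : c * (2 / c * |z.re|) = 2 * |z.re| := by field_simp
    rw [h3] at h1
    have h4 : b * w.im ≤ b * (C * (2 / c * |z.re|) ^ 2) := by gcongr
    have h5 := hsupp w hw
    have h6 : 0 ≤ b * z.im := by positivity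
    refine le_of_mul_le_mul_left (a := b) ?_ hb
    have h7 : b * (C * (2 / c * |z.re|) ^ 2) = b * (C * (2 / c) ^ 2 * z.re ^ 2) := by
      rw [mul_pow, sq_abs]; ring
    linarith
  · exfalso
    -- The set lies below the line: the test point at the largest scale makes the slope small, and
    -- then `w₀` lies above the line.
    obtain ⟨w, hw, h1, -⟩ := htest s₀ hs₀ le_rfl
    have h2 := hsupp w hw
    have h3 : b * w.im ≤ 0 := mul_nonpos_of_nonpos_of_nonneg hb (him w hw)
    have h4 : |a| * |z.re| ≤ |a| * (c * s₀ / 2) := by gcongr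
    have h5 : |a| * (c * s₀ / 2) ≤ -b * z.im := by linarith
    have hcs : 0 < c * s₀ / 2 := by positivity
    have hb' : 0 < -b := by
      rcases hb.lt_or_eq with h | h
      · linarith
      · rw [h] at h5
        have : |a| ≤ 0 := by
          by_contra! h'
          nlinarith [mul_pos h' hcs]
        exact absurd (abs_nonpos_iff.1 this) (by simpa [h] using hab)
    have h6 : |a| ≤ 2 / (c * s₀) * (-b * z.im) := by
      rw [div_mul_eq_mul_div, le_div_iff₀ (by positivity)]; linarith
    have h7 := hsupp w₀ hw₀
    have h8 : a * w₀.re ≤ |a| * |w₀.re| := by rw [← abs_mul]; exact le_abs_self _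
    have h9 : |a| * |z.re| ≤ |a| * 1 := by gcongr
    have h10 : |a| * (|w₀.re| + 1) ≤ 2 / (c * s₀) * (-b * z.im) * (|w₀.re| + 1) := by gcongr
    have h11 : -b * (z.im * B) < -b * w₀.im := by gcongr
    have h12 : -b * (z.im * B)
        = -b * z.im + 2 / (c * s₀) * (-b * z.im) * (|w₀.re| + 1) := by rw [hB]; ring
    linarith

theorem exists_seq_tendsto_of_upperCurvature [CompleteSpace H] {T : H →L[ℂ] H}
    (hW : ∀ w ∈ numericalRange T, 0 ≤ w.im) (h0 : 0 ∈ closure (numericalRange T))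
    (hcurv : upperCurvatureAtZero (numericalRange T) = ⊤) :
    ∃ f : ℕ → H, (∀ n, ‖f n‖ = 1) ∧ Tendsto (fun n => T (f n)) atTop (𝓝 0) := by
  by_cases hb : ∃ δ : ℝ, 0 < δ ∧ ∀ f, ‖f‖ = 1 → δ ≤ ‖T f‖
  · exfalso
    obtain ⟨δ, hδ, hb⟩ := hb
    obtain ⟨c, C, s₀, hc, -, hs₀, hpar⟩ := exists_mem_le_parabola hW h0 hδ hb
    have hfreq : ∀ K r : ℝ, 0 < r → ∃ z ∈ frontier (numericalRange T), z.re ≠ 0 ∧ ‖z‖ < r ∧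
        K < z.im / z.re ^ 2 := by
      intro K r hr
      have h1 := frequently_lt_of_lt_limsup (by isBoundedDefault)
        ((EReal.coe_lt_top K).trans_eq hcurv.symm)
      have h2 := h1.and_eventually (eventually_mem_nhdsWithin.and
        (eventually_nhdsWithin_of_eventually_nhds (Metric.ball_mem_nhds (0 : ℂ) hr)))
      obtain ⟨z, hz1, ⟨hz2, hz3⟩, hz4⟩ := h2.exists
      exact ⟨z, hz2, hz3, mem_ball_zero_iff.1 hz4, EReal.coe_lt_coe_iff.1 hz1⟩
    obtain ⟨w₀, hw₀, hw₀im⟩ : ∃ w ∈ numericalRange T, 0 < w.im := by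
      obtain ⟨z, hz, hx, -, hK⟩ := hfreq 0 1 one_pos
      have hz0 : 0 < z.im := (div_pos_iff_of_pos_right (by positivity)).1 hK
      obtain ⟨w, hw1, hw2⟩ := mem_closure_iff.1 hz.1 {w | 0 < w.im}
        (isOpen_lt continuous_const Complex.continuous_im) hz0
      exact ⟨w, hw2, hw1⟩
    obtain ⟨K, r, hr, hK⟩ := exists_frontier_im_le_mul_sq (convex_numericalRange T) hW h0 hw₀
      hw₀im hc hs₀ hpar
    obtain ⟨z, hz, hx, hzr, hlt⟩ := hfreq K r hr
    rw [lt_div_iff₀ (by positivity)] at hlt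
    exact (hK z hz hx hzr).not_gt hlt
  · push Not at hb
    choose f hf hlt using fun n : ℕ => hb (1 / ((n : ℝ) + 1)) Nat.one_div_pos_of_nat
    refine ⟨f, hf, tendsto_zero_iff_norm_tendsto_zero.2 ?_⟩
    exact squeeze_zero (fun _ => norm_nonneg _) (fun n => (hlt n).le)
      tendsto_one_div_add_atTop_nhds_zero_nat

/-- Rotating the bisector of the sector onto the positive real axis. -/
theorem exists_rotation_of_isCornerPoint {Ω : Set ℂ} {p : ℂ} (h : IsCornerPoint Ω p) :
    ∃ (u : ℂ) (c : ℝ), ‖u‖ = 1 ∧ 0 < c ∧ ∀ w ∈ normalized Ω p u, c * |w.im| ≤ w.re := by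
  obtain ⟨-, t₀, α, hα0, hα, hsub⟩ := h
  refine ⟨Complex.exp ((-(t₀ + α / 2) : ℝ) * Complex.I), Real.cos (α / 2),
    Complex.norm_exp_ofReal_mul_I _, Real.cos_pos_of_mem_Ioo ⟨by linarith, by linarith⟩, ?_⟩
  rintro _ ⟨z, hz, rfl⟩
  obtain ⟨r, t, hr, ht1, ht2, rfl⟩ := hsub hz
  have e : Complex.exp ((-(t₀ + α / 2) : ℝ) * Complex.I)
      * (p + r * Complex.exp (t * Complex.I) - p)
      = r * Complex.exp ((t - (t₀ + α / 2) : ℝ) * Complex.I) := by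
    rw [add_sub_cancel_left, mul_left_comm, ← Complex.exp_add]
    congr 2
    push_cast
    ring
  simp only [e, Complex.re_ofReal_mul, Complex.im_ofReal_mul, Complex.exp_ofReal_mul_I_re,
    Complex.exp_ofReal_mul_I_im, abs_mul, abs_of_nonneg hr]
  have h1 : Real.cos (α / 2) ≤ Real.cos (t - (t₀ + α / 2)) := by
    rw [← Real.cos_abs (t - _)]
    exact Real.cos_le_cos_of_nonneg_of_le_pi (abs_nonneg _) (by linarith)
      (abs_le.2 ⟨by linarith, by linarith⟩)
  have h2 : 0 ≤ Real.cos (α / 2) := Real.cos_nonneg_of_mem_Icc ⟨by linarith, by linarith⟩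
  calc _ ≤ Real.cos (α / 2) * (r * 1) := by
        gcongr; exact Real.abs_sin_le_one _
    _ = r * Real.cos (α / 2) := by ring
    _ ≤ _ := by gcongr

theorem zero_mem_closure_normalized {Ω : Set ℂ} {p : ℂ} (hp : p ∈ closure Ω) (u : ℂ) :
    0 ∈ closure (normalized Ω p u) := by
  have h := image_closure_subset_closure_image (f := fun z : ℂ => u * (z - p)) (by fun_prop)
    (mem_image_of_mem _ hp)
  simpa [normalized] using h

end NumericalRange

theorem theorem2 {H : Type*} [NormedAddCommGroup H] [InnerProductSpace ℂ H] [CompleteSpace H]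
    (A : H →L[ℂ] H) (p : ℂ) (hp : p ∈ frontier (NumericalRange.numericalRange A))
    (hcurv : NumericalRange.IsInfiniteUpperCurvaturePoint (NumericalRange.numericalRange A) p) :
    p ∈ NumericalRange.approxPointSpectrum A := by
  suffices h : ∃ u : ℂ, ‖u‖ = 1 ∧ ∃ f : ℕ → H, (∀ n, ‖f n‖ = 1) ∧
      Tendsto (fun n => (u • (A - p • ContinuousLinearMap.id ℂ H)) (f n)) atTop (𝓝 0) by
    obtain ⟨u, hu, f, hf, hlim⟩ := h
    refine NumericalRange.mem_approxPointSpectrum hf (tendsto_zero_iff_norm_tendsto_zero.2 ?_)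
    simpa [norm_smul, hu] using hlim.norm
  have h0 : ∀ u, 0 ∈ closure
      (NumericalRange.numericalRange (u • (A - p • ContinuousLinearMap.id ℂ H))) := fun u => by
    rw [NumericalRange.numericalRange_smul_sub]
    exact NumericalRange.zero_mem_closure_normalized hp.1 u
  rcases hcurv.2 with hcorner | ⟨-, u, hu, hsub, htop⟩
  · obtain ⟨u, c, hu, hc, hsec⟩ := NumericalRange.exists_rotation_of_isCornerPoint hcorner
    rw [← NumericalRange.numericalRange_smul_sub] at hsec
    exact ⟨u, hu, NumericalRange.exists_seq_tendsto_of_sector (h0 u) hc hsec⟩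
  · rw [← NumericalRange.numericalRange_smul_sub] at hsub htop
    exact ⟨u, hu,
      NumericalRange.exists_seq_tendsto_of_upperCurvature (fun w hw => hsub hw) (h0 u) htop⟩
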